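/- Let $k$ be a field and $h,t\in k$. Let $C_{h,t}=k[x]/(x^2-hx-t)$ be the commutative Frobenius algebra with $\Delta(1)=1\otimes x+x\otimes 1-h\cdot 1\otimes 1$, $\Delta(x)=x\otimes x+t\cdot 1\otimes 1$, $\epsilon(1)=0$, $\epsilon(x)=1$. **Definitions.** A finite-dimensional $k$-algebra $A$ is *strongly separable* if the bilinear form $(a,b)\mapsto\mathrm{tr}_A(L_a\circ L_b)$ is non-degenerate, where $L_a$ is left multiplication by $a$. The *window element* of a symmetric Frobenius algebra $(A,\mu_A,\eta_A,\Delta_A,\epsilon_A)$ is $a=(\mu_A\circ\Delta_A\circ\eta_A)(1)$; it is invertible if $A$ is strongly separable. A *knowledgeable Frobenius algebra* $(A,C,\imath,\imath^*)$ consists of a symmetric Frobenius algebra $A$, a commutative Frobenius algebra $C$, an algebra homomorphism $\imath\colon C\to A$ and a linear map $\imath^*\colon A\to C$ such that $\imath(c)b=b\,\imath(c)$ and $\epsilon_C(c\cdot\imath^*(b))=\epsilon_A(\imath(c)b)$ for all $b\in A$, $c\in C$, and $\mu_A\circ\tau\circ\Delta_A=\imath\circ\imath^*$, where $\tau$ flips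 the two tensor factors. It is a *state sum* knowledgeable Frobenius algebra if $A$ is strongly separable, $\imath$ identifies $C$ with the centre $Z(A)$, and, with $p=(a^{-1}\cdot\mathrm{id}_A)\circ\mu_A\circ\tau\circ\Delta_A$, under this identification $\mu_C=p\circ\mu_A$, $\eta_C=p\circ\eta_A$, $\Delta_C=(p\otimes p)\circ\Delta_A\circ(a\cdot\mathrm{id}_A)$, $\epsilon_C=\epsilon_A\circ(a^{-1}\cdot\mathrm{id}_A)$ and $\imath^*=(a\cdot\mathrm{id}_A)\circ p$. A bounded filtration of a vector space $V$ is a decreasing family of subspaces $(F^jV)_{j\in\mathbb Z}$ with $F^{j}V=V$ for some $j$ and $F^{j}V=0$ for some $j$; for $v\ne0$ put $\deg(v)=\max\{j\mid v\in F^jV\}$. Filter $V\otimes W$ by $F^j(V\otimes W)=\mathrm{span}\{v\otimes w\mid \deg(v)+\deg(w)\ge j\}$ and $k$ by $F^jk=k$ for $j\le0$, $F^jk=0$ for $j\ge1$. A linear map $f\colon V\to W$ is filtered of degree $\ell$ if $f(F^jV)\subseteq F^{j+\ell}W$ for all $j$. A knowledgeable Frobenius algebra $(A,C,\imath,\imath^*)$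 is *Euler-filtered* if $A$ and $C$ admit bounded filtrations for which $\mu_A,\eta_A,\Delta_A,\epsilon_A$ are filtered of degrees $-1,1,-1,1$; $\mu_C,\eta_C,\Delta_C,\epsilon_C$ are filtered of degrees $-2,2,-2,2$; and $\imath,\imath^*$ are filtered of degree $-1$. **Theorem.** Suppose that $C_{h,t}$ is strongly separable and not a field. Then there are $\alpha,\beta\in k$ with $\alpha+\beta=h$ and $\alpha\beta=-t$. Fix any such $\alpha,\beta$, and let $(A,C_{h,t},\imath,\imath^*)$ be a state sum knowledgeable Frobenius algebra with window element $a$. 1. There are an isomorphism of algebras $$A\cong(M_{m_1}(k)\otimes L_1)\oplus(M_{m_2}(k)\otimes L_2),$$ where $L_1,L_2$ are finite-dimensional strongly separable skew field extensions of $k$ with centre $k$ such that $\mathrm{char}\,k$ divides none of $m_1,m_2,\dim_kL_1,\dim_kL_2$, and scalars $\xi_1,\xi_2\in k\setminus\{0\}$ such that $$a=\xi_1z_1+\xi_2z_2,\qquad \xi_1^2=(\alpha-\beta)d_1,\qquad \xi_2^2=(\beta-\alpha)d_2,$$ where $z_1=(I_{m_1}\otimes1,0)$, $z_2=(0,I_{m_2}\otimes1)$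 and $d_j=m_j^2\dim_kL_j$. 2. For every decomposition of $A$ as in part 1, the knowledgeable Frobenius algebra $(A,C_{h,t},\imath,\imath^*)$ is Euler-filtered if and only if there is some $\xi\in k\setminus\{0\}$ with $a=\xi\cdot 1_A$ and $\xi^2=(\alpha-\beta)d_1$, and $\mathrm{char}\,k$ divides $d_1+d_2$. In this case, the filtrations can be chosen such that $\deg(1)=2$ and $\deg(x)=-2$ in $C_{h,t}$. -/

import Mathlib

open scoped TensorProduct

universe u v w

noncomputable section

/-! ### Strongly separable algebras and Frobenius algebras -/

/-- The canonical bilinear form `(x, y) ↦ tr_A (L_x ∘ L_y)` of an algebra, where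
`L = LinearMap.mul k A : A → End A` is the left-regular representation. -/
def canonicalForm (k : Type u) (A : Type v) [Field k] [Ring A] [Algebra k A] :
    LinearMap.BilinForm k A :=
  ((LinearMap.mul k (Module.End k A)).compl₁₂ (LinearMap.mul k A) (LinearMap.mul k A)).compr₂
    (LinearMap.trace k A)

theorem canonicalForm_apply (k : Type u) (A : Type v) [Field k] [Ring A] [Algebra k A]
    (x y : A) : canonicalForm k A x y =
      LinearMap.trace k A (LinearMap.mulLeft k x ∘ₗ LinearMap.mulLeft k y) := rfl

/-- An algebra is strongly separable if it is finite-dimensional and its canonical bilinear form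
is non-degenerate. -/
def IsStronglySeparable (k : Type u) (A : Type v) [Field k] [Ring A] [Algebra k A] : Prop :=
  FiniteDimensional k A ∧ (canonicalForm k A).Nondegenerate

section Frobenius

variable (k : Type u) (A : Type v) [Field k] [Ring A] [Algebra k A] [Coalgebra k A]

/-- The multiplication `μ : A ⊗ A → A` and comultiplication of a unital algebra that is also
a counital coalgebra satisfy the Frobenius condition
`(id ⊗ μ) ∘ (Δ ⊗ id) = Δ ∘ μ = (μ ⊗ id) ∘ (id ⊗ Δ)`. -/
structure IsFrobeniusAlgebra : Prop where
  lTensor_mul_comp :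
    (LinearMap.mul' k A).lTensor A ∘ₗ (TensorProduct.assoc k A A A).toLinearMap ∘ₗ
        (Coalgebra.comul (R := k) (A := A)).rTensor A =
      Coalgebra.comul (R := k) (A := A) ∘ₗ LinearMap.mul' k A
  rTensor_mul_comp :
    (LinearMap.mul' k A).rTensor A ∘ₗ (TensorProduct.assoc k A A A).symm.toLinearMap ∘ₗ
        (Coalgebra.comul (R := k) (A := A)).lTensor A =
      Coalgebra.comul (R := k) (A := A) ∘ₗ LinearMap.mul' k A

/-- A symmetric Frobenius algebra: `ε (x y) = ε (y x)`. -/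
structure IsSymmetricFrobeniusAlgebra : Prop extends IsFrobeniusAlgebra k A where
  counit_mul_comm : ∀ x y : A, Coalgebra.counit (R := k) (x * y) = Coalgebra.counit (R := k) (y * x)

/-- The window element `a = (μ ∘ Δ ∘ η) (1)`. -/
def windowElement : A := LinearMap.mul' k A (Coalgebra.comul (R := k) (1 : A))

/-- The linear map `μ ∘ τ ∘ Δ : A → A`, where `τ` is the flip of the two tensor factors. -/
def twistedHandle : A →ₗ[k] A :=
  LinearMap.mul' k A ∘ₗ (TensorProduct.comm k A A).toLinearMap ∘ₗ
    Coalgebra.comul (R := k) (A := A)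

/-- The linear map `p = (a⁻¹ · id) ∘ μ ∘ τ ∘ Δ : A → A`, where `a` is the window element. -/
def centerProj : A →ₗ[k] A :=
  LinearMap.mulLeft k (Ring.inverse (windowElement k A)) ∘ₗ twistedHandle k A

end Frobenius

/-! ### Knowledgeable Frobenius algebras -/

/-- A knowledgeable Frobenius algebra `(A, C, ι, ι*)`. -/
structure KnowledgeableFrobenius (k : Type u) (A : Type v) (C : Type w) [Field k]
    [Ring A] [Algebra k A] [Coalgebra k A] [CommRing C] [Algebra k C] [Coalgebra k C] where
  symmetric_A : IsSymmetricFrobeniusAlgebra k A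
  frobenius_C : IsFrobeniusAlgebra k C
  /-- the algebra homomorphism `ι : C → A` -/
  incl : C →ₐ[k] A
  /-- the linear map `ι* : A → C` -/
  coincl : A →ₗ[k] C
  knowledge : ∀ (c : C) (x : A), incl c * x = x * incl c
  duality : ∀ (c : C) (x : A),
    Coalgebra.counit (R := k) (c * coincl x) = Coalgebra.counit (R := k) (incl c * x)
  cardy : twistedHandle k A = incl.toLinearMap ∘ₗ coincl

namespace KnowledgeableFrobenius

variable {k : Type u} {A : Type v} {C : Type w} [Field k]
  [Ring A] [Algebra k A] [Coalgebra k A] [CommRing C] [Algebra k C] [Coalgebra k C]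

/-- `(A, C, ι, ι*)` is a state sum knowledgeable Frobenius algebra: `A` is strongly separable,
`ι` identifies `C` with the centre `Z(A)`, and under this identification the structure maps are
`μ_C = p ∘ μ_A`, `η_C = p ∘ η_A`, `Δ_C = (p ⊗ p) ∘ Δ_A ∘ (a · id)`, `ε_C = ε_A ∘ (a⁻¹ · id)` and
`ι* = (a · id) ∘ p`, where `a` is the (invertible) window element of `A`. -/
structure IsStateSum (K : KnowledgeableFrobenius k A C) : Prop where
  stronglySeparable : IsStronglySeparable k A
  isUnit_window : IsUnit (windowElement k A)
  incl_injective : Function.Injective K.incl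
  range_incl : K.incl.range = Subalgebra.center k A
  incl_mul : ∀ c d : C, K.incl (c * d) = centerProj k A (K.incl c * K.incl d)
  incl_one : K.incl 1 = centerProj k A 1
  comul_eq : ∀ c : C,
    TensorProduct.map K.incl.toLinearMap K.incl.toLinearMap (Coalgebra.comul (R := k) c) =
      TensorProduct.map (centerProj k A) (centerProj k A)
        (Coalgebra.comul (R := k) (windowElement k A * K.incl c))
  counit_eq : ∀ c : C, Coalgebra.counit (R := k) c =
    Coalgebra.counit (R := k) (Ring.inverse (windowElement k A) * K.incl c)
  incl_coincl : ∀ x : A, K.incl (K.coincl x) = windowElement k A * centerProj k A x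

end KnowledgeableFrobenius

/-! ### Filtrations -/

section Filtration

variable {k : Type u} [Field k] {V : Type v} {W : Type w} [AddCommGroup V] [Module k V]
  [AddCommGroup W] [Module k W]

/-- `F` is a bounded (decreasing, `ℤ`-indexed) filtration of `V`. -/
structure IsBoundedFiltration (F : ℤ → Submodule k V) : Prop where
  anti : ∀ j, F (j + 1) ≤ F j
  exists_eq_top : ∃ j, F j = ⊤
  exists_eq_bot : ∃ j, F j = ⊥

/-- `deg v = d`, i.e. `d` is the largest `j` with `v ∈ F^j V`. -/
def HasFiltrationDegree (F : ℤ → Submodule k V) (v : V) (d : ℤ) : Prop :=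
  IsGreatest {j : ℤ | v ∈ F j} d

/-- The filtration of `V ⊗ W`: `F^j (V ⊗ W)` is spanned by the `v ⊗ w` with
`deg v + deg w ≥ j`, i.e. with `v ∈ F^p V`, `w ∈ F^q W` for some `p + q ≥ j`. -/
def tensorFiltration (F : ℤ → Submodule k V) (G : ℤ → Submodule k W) (j : ℤ) :
    Submodule k (V ⊗[k] W) :=
  Submodule.span k {z | ∃ p q : ℤ, j ≤ p + q ∧ ∃ x ∈ F p, ∃ y ∈ G q, x ⊗ₜ[k] y = z}

variable (k) in
/-- The filtration of the ground field: `F^0 k = k` and `F^1 k = 0`. -/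
def fieldFiltration (j : ℤ) : Submodule k k := if j ≤ 0 then ⊤ else ⊥

/-- A linear map is filtered of degree `l` if it maps `F^j V` to `F^(j + l) W` for all `j`. -/
def IsFilteredOfDegree (F : ℤ → Submodule k V) (G : ℤ → Submodule k W) (f : V →ₗ[k] W)
    (l : ℤ) : Prop :=
  ∀ j : ℤ, ∀ x ∈ F j, f x ∈ G (j + l)

end Filtration

namespace KnowledgeableFrobenius

variable {k : Type u} {A : Type v} {C : Type w} [Field k]
  [Ring A] [Algebra k A] [Coalgebra k A] [CommRing C] [Algebra k C] [Coalgebra k C]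

/-- The filtrations `FA` of `A` and `FC` of `C` make `(A, C, ι, ι*)` Euler-filtered. -/
structure IsEulerFiltration (K : KnowledgeableFrobenius k A C)
    (FA : ℤ → Submodule k A) (FC : ℤ → Submodule k C) : Prop where
  filtration_A : IsBoundedFiltration FA
  filtration_C : IsBoundedFiltration FC
  mul_A : IsFilteredOfDegree (tensorFiltration FA FA) FA (LinearMap.mul' k A) (-1)
  unit_A : IsFilteredOfDegree (fieldFiltration k) FA (Algebra.linearMap k A) 1
  comul_A : IsFilteredOfDegree FA (tensorFiltration FA FA) Coalgebra.comul (-1)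
  counit_A : IsFilteredOfDegree FA (fieldFiltration k) Coalgebra.counit 1
  mul_C : IsFilteredOfDegree (tensorFiltration FC FC) FC (LinearMap.mul' k C) (-2)
  unit_C : IsFilteredOfDegree (fieldFiltration k) FC (Algebra.linearMap k C) 2
  comul_C : IsFilteredOfDegree FC (tensorFiltration FC FC) Coalgebra.comul (-2)
  counit_C : IsFilteredOfDegree FC (fieldFiltration k) Coalgebra.counit 2
  incl : IsFilteredOfDegree FC FA K.incl.toLinearMap (-1)
  coincl : IsFilteredOfDegree FA FC K.coincl (-1)

/-- `(A, C, ι, ι*)` is Euler-filtered: there are filtrations of `A` and `C` for which the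
structure maps are filtered of the degrees above. -/
def IsEulerFiltered (K : KnowledgeableFrobenius k A C) : Prop :=
  ∃ (FA : ℤ → Submodule k A) (FC : ℤ → Submodule k C), K.IsEulerFiltration FA FC

end KnowledgeableFrobenius

/-! ### The Frobenius algebra `C_{h,t}` -/

section Universal

variable {k : Type u} [Field k] (h t : k)

open Polynomial in
/-- The polynomial `x² - h x - t`. -/
def frobPoly : k[X] := X ^ 2 - C h * X - C t

theorem frobPoly_natDegree : (frobPoly h t).natDegree = 2 := by
  unfold frobPoly; compute_degree!

theorem frobPoly_monic : (frobPoly h t).Monic := by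
  unfold frobPoly; monicity!

/-- The algebra `C_{h,t} = k[x] / (x² - h x - t)`. -/
abbrev FrobC : Type u := AdjoinRoot (frobPoly h t)

/-- The class of `x` in `C_{h,t}`. -/
def frobX : FrobC h t := AdjoinRoot.root (frobPoly h t)

/-- The basis `{1, x}` of `C_{h,t}`. -/
def frobBasis : Module.Basis (Fin 2) k (FrobC h t) :=
  (AdjoinRoot.powerBasis' (frobPoly_monic h t)).basis.reindex
    (finCongr (frobPoly_natDegree h t))

theorem frobBasis_zero : frobBasis h t 0 = 1 := by
  rw [frobBasis, Module.Basis.reindex_apply, PowerBasis.basis_eq_pow]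
  exact pow_zero _

theorem frobBasis_one : frobBasis h t 1 = frobX h t := by
  rw [frobBasis, Module.Basis.reindex_apply, PowerBasis.basis_eq_pow]
  exact pow_one _

theorem frobX_mul_self :
    frobX h t * frobX h t = algebraMap k _ h * frobX h t + algebraMap k _ t := by
  have e : Polynomial.aeval (AdjoinRoot.root (frobPoly h t))
      (Polynomial.X ^ 2 - Polynomial.C h * Polynomial.X - Polynomial.C t) = 0 :=
    AdjoinRoot.eval₂_root (frobPoly h t)
  simp only [map_sub, map_mul, map_pow, Polynomial.aeval_X, Polynomial.aeval_C] at e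
  unfold frobX
  linear_combination e

/-- `Δ(1) = 1 ⊗ x + x ⊗ 1 - h · 1 ⊗ 1` and `Δ(x) = x ⊗ x + t · 1 ⊗ 1`. -/
def frobComul : FrobC h t →ₗ[k] FrobC h t ⊗[k] FrobC h t :=
  (frobBasis h t).constr k
    ![1 ⊗ₜ[k] frobX h t + frobX h t ⊗ₜ[k] 1 - h • ((1 : FrobC h t) ⊗ₜ[k] (1 : FrobC h t)),
      frobX h t ⊗ₜ[k] frobX h t + t • ((1 : FrobC h t) ⊗ₜ[k] (1 : FrobC h t))]

/-- `ε(1) = 0` and `ε(x) = 1`. -/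
def frobCounit : FrobC h t →ₗ[k] k := (frobBasis h t).constr k ![0, 1]

theorem frobComul_one : frobComul h t 1 =
    1 ⊗ₜ[k] frobX h t + frobX h t ⊗ₜ[k] 1 - h • ((1 : FrobC h t) ⊗ₜ[k] (1 : FrobC h t)) := by
  rw [← frobBasis_zero, frobComul, Module.Basis.constr_basis]; simp [frobBasis_zero]

theorem frobComul_x : frobComul h t (frobX h t) =
    frobX h t ⊗ₜ[k] frobX h t + t • ((1 : FrobC h t) ⊗ₜ[k] (1 : FrobC h t)) := by
  conv_lhs => rw [← frobBasis_one, frobComul, Module.Basis.constr_basis]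
  simp

theorem frobCounit_one : frobCounit h t 1 = 0 := by
  rw [← frobBasis_zero, frobCounit, Module.Basis.constr_basis]; simp

theorem frobCounit_x : frobCounit h t (frobX h t) = 1 := by
  rw [← frobBasis_one, frobCounit, Module.Basis.constr_basis]; simp

/-- Linear maps out of `C_{h,t}` are determined by their values on `1` and `x`. -/
theorem frobC_hom_ext {M : Type w} [AddCommGroup M] [Module k M] {f g : FrobC h t →ₗ[k] M}
    (h1 : f 1 = g 1) (hx : f (frobX h t) = g (frobX h t)) : f = g := by
  refine (frobBasis h t).ext fun i => ?_
  fin_cases i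
  · simpa [frobBasis_zero] using h1
  · simpa [frobBasis_one] using hx

/-- The coalgebra structure `(Δ, ε)` of `C_{h,t}`. -/
instance frobCoalgebra : Coalgebra k (FrobC h t) where
  comul := frobComul h t
  counit := frobCounit h t
  coassoc := by
    apply frobC_hom_ext
    · simp [frobComul_one, frobComul_x, TensorProduct.add_tmul, TensorProduct.tmul_add,
        TensorProduct.sub_tmul, TensorProduct.tmul_sub, ← TensorProduct.smul_tmul',
        TensorProduct.tmul_smul, map_smul, smul_sub, smul_add]
      abel
    · simp [frobComul_one, frobComul_x, TensorProduct.add_tmul, TensorProduct.tmul_add,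
        TensorProduct.sub_tmul, TensorProduct.tmul_sub, ← TensorProduct.smul_tmul',
        TensorProduct.tmul_smul, map_smul, smul_sub, smul_add, smul_comm t h]
      abel
  rTensor_counit_comp_comul := by
    apply frobC_hom_ext
    · simp [frobComul_one, frobCounit_one, frobCounit_x]
    · simp [frobComul_x, frobCounit_one, frobCounit_x]
  lTensor_counit_comp_comul := by
    apply frobC_hom_ext
    · simp [frobComul_one, frobCounit_one, frobCounit_x]
    · simp [frobComul_x, frobCounit_one, frobCounit_x]

/-- `C_{h,t}` is a (commutative) Frobenius algebra. -/
theorem frobC_isFrobeniusAlgebra : IsFrobeniusAlgebra k (FrobC h t) := by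
  have hc : Coalgebra.comul (R := k) (A := FrobC h t) = frobComul h t := rfl
  have hx : frobX h t * frobX h t = h • frobX h t + t • 1 := by
    rw [frobX_mul_self, Algebra.smul_def, Algebra.smul_def, mul_one]
  constructor
  all_goals
    refine TensorProduct.ext (frobC_hom_ext (M := FrobC h t →ₗ[k] FrobC h t ⊗[k] FrobC h t) h t
      (frobC_hom_ext h t ?_ ?_) (frobC_hom_ext h t ?_ ?_)) <;>
    simp [hc, frobComul_one, frobComul_x, hx, TensorProduct.add_tmul, TensorProduct.tmul_add,
      TensorProduct.sub_tmul, TensorProduct.tmul_sub, ← TensorProduct.smul_tmul',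
      TensorProduct.tmul_smul, map_smul, smul_sub, smul_add, smul_comm t h] <;>
    abel

end Universal

/-! ### Decompositions of the open algebra -/

/-- An isomorphism of algebras `A ≅ (M_{m₁}(k) ⊗ L₁) ⊕ (M_{m₂}(k) ⊗ L₂)`, where `L₁`, `L₂` are
finite-dimensional strongly separable central skew field extensions of `k` such that the
characteristic of `k` divides none of `m₁`, `m₂`, `dim L₁`, `dim L₂`. -/
structure SkewDecomposition (k : Type u) (A : Type v) [Field k] [Ring A] [Algebra k A] where
  m₁ : ℕ
  m₂ : ℕ
  L₁ : Type v
  L₂ : Type v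
  [divisionRing₁ : DivisionRing L₁]
  [divisionRing₂ : DivisionRing L₂]
  [algebra₁ : Algebra k L₁]
  [algebra₂ : Algebra k L₂]
  [finite₁ : FiniteDimensional k L₁]
  [finite₂ : FiniteDimensional k L₂]
  [central₁ : Algebra.IsCentral k L₁]
  [central₂ : Algebra.IsCentral k L₂]
  stronglySeparable₁ : IsStronglySeparable k L₁
  stronglySeparable₂ : IsStronglySeparable k L₂
  not_dvd_m₁ : ¬ ringChar k ∣ m₁
  not_dvd_m₂ : ¬ ringChar k ∣ m₂
  not_dvd_dim₁ : ¬ ringChar k ∣ Module.finrank k L₁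
  not_dvd_dim₂ : ¬ ringChar k ∣ Module.finrank k L₂
  equiv : A ≃ₐ[k]
    (Matrix (Fin m₁) (Fin m₁) k ⊗[k] L₁) × (Matrix (Fin m₂) (Fin m₂) k ⊗[k] L₂)

namespace SkewDecomposition

variable {k : Type u} {A : Type v} [Field k] [Ring A] [Algebra k A] (D : SkewDecomposition k A)

attribute [instance] divisionRing₁ divisionRing₂ algebra₁ algebra₂ finite₁ finite₂ central₁
  central₂

/-- The central element `z₁ = (I ⊗ 1, 0)`. -/
def z₁ : A := D.equiv.symm ((1 : Matrix (Fin D.m₁) (Fin D.m₁) k) ⊗ₜ[k] (1 : D.L₁), 0)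

/-- The central element `z₂ = (0, I ⊗ 1)`. -/
def z₂ : A := D.equiv.symm (0, (1 : Matrix (Fin D.m₂) (Fin D.m₂) k) ⊗ₜ[k] (1 : D.L₂))

/-- `d₁ = m₁² dim L₁`. -/
def d₁ : ℕ := D.m₁ ^ 2 * Module.finrank k D.L₁

/-- `d₂ = m₂² dim L₂`. -/
def d₂ : ℕ := D.m₂ ^ 2 * Module.finrank k D.L₂

/-- The element `a` is of the form `ξ₁ z₁ + ξ₂ z₂` with non-zero scalars such that
`ξ₁² = (α - β) d₁` and `ξ₂² = (β - α) d₂`. -/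
def HasWindowForm (a : A) (α β : k) : Prop :=
  ∃ ξ₁ ξ₂ : k, ξ₁ ≠ 0 ∧ ξ₂ ≠ 0 ∧ a = ξ₁ • D.z₁ + ξ₂ • D.z₂ ∧
    ξ₁ ^ 2 = (α - β) * (D.d₁ : k) ∧ ξ₂ ^ 2 = (β - α) * (D.d₂ : k)

end SkewDecomposition

end

/-! Since `C_{h,t}` is not a field, its quadratic polynomial splits, and strong separability forces
`α ≠ β`: a double root would give a non-zero nilpotent in the radical of the trace form. Hence
`C_{h,t} ≅ k × k`, with idempotents `e = (x - β)/(α - β)` and `f = 1 - e`. Their images `y₁, y₂` in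
`A` span the centre, so Wedderburn's theorem gives exactly two blocks, with central division
algebras (`exists_algEquiv_prod_matrix`).

The window element `a = ι(ι*(1))` is central, so `a = ξ₁ y₁ + ξ₂ y₂`. Two formulas determine `ξ₁`:
the state sum condition gives `(α - β)⁻¹ = ε_C(e) = ξ₁⁻¹ ε_A(y₁)`, and `tr L_x = ε_A(x a)`
(`trace_mulLeft`) gives `d₁ = tr L_{y₁} = ξ₁ ε_A(y₁)`. So `ξ₁² = (α - β) d₁`, and by symmetry `ξ₂² =
(β - α) d₂` (`window_scalar`). As the `ξⱼ` are non-zero, so are the `dⱼ` in `k`, which gives the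
divisibility conditions.

In an Euler filtration, degrees force `ε_C(ι*(1)) = 0`. Since `ker ε_C = k·1`, `a` is a scalar `ξ`;
then `ξ₁ = ξ₂` and comparing squares gives `d₁ + d₂ = 0` in `k`. Conversely, for `a = ξ` the trace
formula gives `ξ ε_A(1) = dim A = d₁ + d₂ = 0`, so `ε_A(1) = 0` and the explicit filtrations `A ⊇
ker ε ⊇ k ⊇ 0` and `C ⊇ k ⊇ 0` work (`isEulerFiltration`). -/

noncomputable section

/-! ### Strong separability -/

section StronglySeparable

variable {k : Type u} {A : Type v} [Field k] [Ring A] [Algebra k A]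

/-- An element generating only nilpotents is zero in a strongly separable algebra. -/
theorem IsStronglySeparable.eq_zero_of_isNilpotent_mul (hA : IsStronglySeparable k A) {x : A}
    (hx : ∀ y, IsNilpotent (x * y)) : x = 0 := by
  refine hA.2.1 x fun y => ?_
  rw [canonicalForm_apply, ← LinearMap.mulLeft_mul]
  have h1 : IsNilpotent (LinearMap.mulLeft k (x * y)) := by
    obtain ⟨n, hn⟩ := hx y
    exact ⟨n, by rw [LinearMap.pow_mulLeft, hn]; ext; simp⟩
  exact (LinearMap.isNilpotent_trace_of_isNilpotent h1).eq_zero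

/-- The Jacobson radical of an Artinian ring is a nilpotent two-sided ideal, so each of its elements
generates only nilpotents and lies in the radical of the trace form. -/
theorem IsStronglySeparable.isSemisimpleRing (hA : IsStronglySeparable k A) :
    IsSemisimpleRing A := by
  have := hA.1
  have : IsArtinianRing A := IsArtinianRing.of_finite k A
  rw [IsArtinianRing.isSemisimpleRing_iff_jacobson, eq_bot_iff]
  intro x hx
  obtain ⟨n, hn⟩ := IsSemiprimaryRing.isNilpotent (R := A)
  refine hA.eq_zero_of_isNilpotent_mul fun y => ⟨n, ?_⟩
  have hy : x * y ∈ Ring.jacobson A := Ideal.mul_mem_right y _ hx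
  have := Ideal.pow_mem_pow hy n
  rwa [hn] at this

/-- A division algebra whose dimension is non-zero in `k` is strongly separable. -/
theorem isStronglySeparable_of_finrank_ne_zero {L : Type w} [DivisionRing L] [Algebra k L]
    [FiniteDimensional k L] (hL : (Module.finrank k L : k) ≠ 0) : IsStronglySeparable k L := by
  -- Pairing `x ≠ 0` with `x⁻¹` gives `tr L_1 = dim L`, so this non-vanishing suffices.
  have key : LinearMap.trace k L (LinearMap.mulLeft k (1 : L)) ≠ 0 := by
    rwa [LinearMap.mulLeft_one, LinearMap.trace_id]
  refine ⟨inferInstance, fun x hx => ?_, fun x hx => ?_⟩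
  all_goals
    by_contra h0
    apply key
    have := hx x⁻¹
    rw [canonicalForm_apply, ← LinearMap.mulLeft_mul] at this
    simpa [h0] using this

end StronglySeparable

/-! ### The trace formula in a symmetric Frobenius algebra -/

section Frobenius

variable {k : Type u} {A : Type v} [Field k] [Ring A] [Algebra k A] [Coalgebra k A]

/-- `Δ(x) = Δ(1) (1 ⊗ x)`. -/
theorem IsFrobeniusAlgebra.comul_eq_lTensor (hA : IsFrobeniusAlgebra k A) (x : A) :
    Coalgebra.comul (R := k) x =
      (LinearMap.mulRight k x).lTensor A (Coalgebra.comul (R := k) (1 : A)) := by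
  have h1 := LinearMap.congr_fun hA.lTensor_mul_comp ((1 : A) ⊗ₜ[k] x)
  simp only [LinearMap.comp_apply, LinearMap.rTensor_tmul, LinearMap.mul'_apply, one_mul,
    LinearEquiv.coe_coe] at h1
  rw [← h1]
  induction Coalgebra.comul (R := k) (1 : A) with
  | zero => simp
  | tmul a b => simp
  | add a b ha hb => simp only [TensorProduct.add_tmul, map_add, ha, hb]

/-- `tr(L_x) = ε(x a)`, with `a` the window element. -/
theorem IsSymmetricFrobeniusAlgebra.trace_mulLeft [FiniteDimensional k A]
    (hA : IsSymmetricFrobeniusAlgebra k A) (x : A) :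
    LinearMap.trace k A (LinearMap.mulLeft k x) =
      Coalgebra.counit (R := k) (x * windowElement k A) := by
  obtain ⟨S, hS⟩ := TensorProduct.exists_finset (Coalgebra.comul (R := k) (1 : A))
  -- The counit axiom applied to `Δ(y) = Δ(1)(1 ⊗ y)`: the two legs of `Δ(1)` act as dual families
  -- for the form `ε(xy)`.
  have hid (y : A) : y = ∑ i ∈ S, Coalgebra.counit (R := k) (i.2 * y) • i.1 := by
    have h1 := LinearMap.congr_fun (Coalgebra.lTensor_counit_comp_comul (R := k) (A := A)) y
    rw [LinearMap.comp_apply, hA.comul_eq_lTensor, hS] at h1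
    have h2 := congrArg (TensorProduct.rid k A) h1
    simpa using h2.symm
  -- A sum of rank-one maps, whose trace can be read off termwise.
  have hx : LinearMap.mulLeft k x =
      ∑ i ∈ S, ((Coalgebra.counit (R := k) (A := A)) ∘ₗ LinearMap.mulLeft k i.2).smulRight
        (x * i.1) := by
    ext y
    conv_lhs => rw [LinearMap.mulLeft_apply, hid y]
    simp [Finset.mul_sum]
  rw [hx, windowElement, hS]
  simp only [map_sum, LinearMap.trace_smulRight, LinearMap.mul'_apply, Finset.mul_sum,
    LinearMap.comp_apply, LinearMap.mulLeft_apply]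
  refine Finset.sum_congr rfl fun i _ => ?_
  rw [hA.counit_mul_comm, mul_assoc]

end Frobenius

/-! ### The window element as a central element -/

namespace KnowledgeableFrobenius.IsStateSum

variable {k : Type u} {A : Type v} {C : Type w} [Field k]
  [Ring A] [Algebra k A] [Coalgebra k A] [CommRing C] [Algebra k C] [Coalgebra k C]
  {K : KnowledgeableFrobenius k A C}

/-- The unit condition says `p(1) = ι(1) = 1`. This places `a` in the image of `ι`, and hence makes
it central. -/
theorem incl_coincl_one (hK : K.IsStateSum) : K.incl (K.coincl 1) = windowElement k A := by
  rw [hK.incl_coincl, ← hK.incl_one, map_one, mul_one]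

theorem mul_comm_window (hK : K.IsStateSum) (x : A) :
    windowElement k A * x = x * windowElement k A := by
  rw [← hK.incl_coincl_one, K.knowledge]

/-- `ι` identifies `C` with the centre. -/
theorem exists_incl_eq (hK : K.IsStateSum) {x : A} (hx : ∀ y, y * x = x * y) :
    ∃ c, K.incl c = x := by
  have : x ∈ K.incl.range := by
    rw [hK.range_incl, Subalgebra.mem_center_iff]; exact hx
  exact this

end KnowledgeableFrobenius.IsStateSum

/-! ### Splitting of `C_{h,t}` into idempotents -/

section Universal

variable {k : Type u} [Field k] {h t α β : k}

/-- A quadratic without roots is irreducible, and its quotient ring would be a field. The second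
root is `h - α`. -/
theorem exists_roots_of_not_isField (hf : ¬ IsField (FrobC h t)) :
    ∃ α β : k, α + β = h ∧ α * β = -t := by
  have hirr : ¬ Irreducible (frobPoly h t) := fun hi => by
    have : Fact (Irreducible (frobPoly h t)) := ⟨hi⟩
    exact hf (Field.toIsField (AdjoinRoot (frobPoly h t)))
  rw [(frobPoly_monic h t).irreducible_iff_roots_eq_zero_of_degree_le_three
    (frobPoly_natDegree h t).ge ((frobPoly_natDegree h t).le.trans (by norm_num))] at hirr
  obtain ⟨α, hα⟩ := Multiset.exists_mem_of_ne_zero hirr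
  have hr := Polynomial.isRoot_of_mem_roots hα
  simp only [frobPoly, Polynomial.IsRoot.def, Polynomial.eval_sub, Polynomial.eval_mul,
    Polynomial.eval_pow, Polynomial.eval_X, Polynomial.eval_C] at hr
  exact ⟨α, h - α, by ring, by linear_combination -hr⟩

theorem frobC_exists_eq (c : FrobC h t) : ∃ r s : k, c = r • 1 + s • frobX h t := by
  refine ⟨(frobBasis h t).repr c 0, (frobBasis h t).repr c 1, ?_⟩
  conv_lhs => rw [← (frobBasis h t).sum_repr c]
  rw [Fin.sum_univ_two, frobBasis_zero, frobBasis_one]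

theorem frobC_counit_smul_add (r s : k) :
    Coalgebra.counit (R := k) (r • 1 + s • frobX h t) = s := by
  change frobCounit h t _ = _
  simp [frobCounit_one, frobCounit_x]

theorem frobC_one_ne_zero : (1 : FrobC h t) ≠ 0 := by
  rw [← frobBasis_zero]; exact (frobBasis h t).ne_zero 0

theorem frobC_smul_add_eq_zero {r s : k} (hrs : r • 1 + s • frobX h t = 0) : r = 0 ∧ s = 0 := by
  have hs : s = 0 := by rw [← frobC_counit_smul_add (h := h) (t := t) r s, hrs, map_zero]
  subst hs
  simpa [frobC_one_ne_zero] using hrs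

theorem frobX_mul_self' (h1 : α + β = h) (h2 : α * β = -t) :
    (frobX h t - algebraMap k _ α) * (frobX h t - algebraMap k _ β) = 0 := by
  have ht : t = -(α * β) := by rw [h2, neg_neg]
  have := frobX_mul_self h t
  rw [sub_mul, mul_sub, mul_sub, this, ← map_mul, h2, ← h1]
  simp only [map_add, map_neg]; ring

/-- For a double root, `(x - α)² = 0`, so every multiple of the non-zero element `x - α` is
nilpotent. -/
theorem roots_ne_of_isStronglySeparable (hsep : IsStronglySeparable k (FrobC h t))
    (h1 : α + β = h) (h2 : α * β = -t) : α ≠ β := by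
  rintro rfl
  have h0 : frobX h t - algebraMap k _ α = 0 :=
    hsep.eq_zero_of_isNilpotent_mul fun y => ⟨2, by
      rw [mul_pow, pow_two, frobX_mul_self' h1 h2, zero_mul]⟩
  have := frobC_smul_add_eq_zero (h := h) (t := t) (r := -α) (s := 1) (by
    rw [← h0, Algebra.algebraMap_eq_smul_one]; module)
  exact one_ne_zero this.2

variable (h t) in
/-- The idempotent `(x - β) / (α - β)` of `C_{h,t}`. -/
def frobIdem (α β : k) : FrobC h t := (α - β)⁻¹ • (frobX h t - algebraMap k _ β)

theorem frobIdem_add (hne : α ≠ β) : frobIdem h t α β + frobIdem h t β α = 1 := by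
  have h3 : α - β ≠ 0 := sub_ne_zero.mpr hne
  have h4 : (β - α)⁻¹ = -(α - β)⁻¹ := by rw [← neg_sub, inv_neg]
  have h5 : (α - β)⁻¹ * α = 1 + (α - β)⁻¹ * β := by field_simp; ring
  rw [frobIdem, frobIdem, h4, Algebra.algebraMap_eq_smul_one, Algebra.algebraMap_eq_smul_one,
    smul_sub, smul_sub, smul_smul, smul_smul, neg_mul, h5]
  module

theorem frobIdem_mul (h1 : α + β = h) (h2 : α * β = -t) :
    frobIdem h t α β * frobIdem h t β α = 0 := by
  rw [frobIdem, frobIdem, smul_mul_smul_comm, mul_comm (frobX h t - _), frobX_mul_self' h1 h2,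
    smul_zero]

theorem frobIdem_mul_self (hne : α ≠ β) (h1 : α + β = h) (h2 : α * β = -t) :
    frobIdem h t α β * frobIdem h t α β = frobIdem h t α β := by
  have := frobIdem_mul h1 h2
  rwa [← sub_eq_iff_eq_add'.mpr (frobIdem_add (h := h) (t := t) hne).symm, mul_sub, mul_one,
    sub_eq_zero, eq_comm] at this

theorem counit_frobIdem : Coalgebra.counit (R := k) (frobIdem h t α β) = (α - β)⁻¹ := by
  rw [frobIdem, Algebra.algebraMap_eq_smul_one, map_smul,
    show frobX h t - β • 1 = (-β) • (1 : FrobC h t) + (1 : k) • frobX h t by module,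
    frobC_counit_smul_add, smul_eq_mul, mul_one]

theorem frobC_exists_eq_frobIdem (hne : α ≠ β) (c : FrobC h t) :
    ∃ r s : k, c = r • frobIdem h t α β + s • frobIdem h t β α := by
  obtain ⟨r, s, rfl⟩ := frobC_exists_eq c
  have h3 : α - β ≠ 0 := sub_ne_zero.mpr hne
  have hx : frobX h t = α • frobIdem h t α β + β • frobIdem h t β α := by
    have e : (α - β) • frobIdem h t α β = frobX h t - algebraMap k _ β := by
      rw [frobIdem, smul_inv_smul₀ h3]
    have e2 : β • (1 : FrobC h t) = β • frobIdem h t α β + β • frobIdem h t β α := by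
      rw [← smul_add, frobIdem_add hne]
    rw [sub_smul, Algebra.algebraMap_eq_smul_one, e2] at e
    have := sub_eq_iff_eq_add.mp e.symm
    rw [this]; abel
  -- The coordinates are the values of `r + s x` at the two roots.
  refine ⟨r + s * α, r + s * β, ?_⟩
  conv_lhs => rw [hx, ← frobIdem_add (h := h) (t := t) hne]
  module

theorem frobIdem_ne_zero (hne : α ≠ β) : frobIdem h t α β ≠ 0 := fun h0 => by
  have := counit_frobIdem (h := h) (t := t) (α := α) (β := β)
  rw [h0, map_zero] at this
  exact inv_ne_zero (sub_ne_zero.mpr hne) this.symm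

end Universal

/-! ### Wedderburn decomposition with two blocks -/

section Wedderburn

variable {k : Type u} {A : Type v} [Field k] [Ring A] [Algebra k A]

/-- A finite semisimple algebra whose centre is spanned by two orthogonal idempotents is a product
of two matrix algebras over central division algebras. -/
theorem exists_algEquiv_prod_matrix [FiniteDimensional k A] [IsSemisimpleRing A] {y₁ y₂ : A}
    (hadd : y₁ + y₂ = 1) (hmul : y₁ * y₂ = 0) (h₁ : y₁ ≠ 0) (h₂ : y₂ ≠ 0)
    (hc₁ : ∀ x, y₁ * x = x * y₁) (hc₂ : ∀ x, y₂ * x = x * y₂)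
    (hcent : ∀ x : A, (∀ y, y * x = x * y) → ∃ r s : k, x = r • y₁ + s • y₂) :
    ∃ (m₁ m₂ : ℕ) (L₁ L₂ : Type v) (_ : DivisionRing L₁) (_ : DivisionRing L₂)
      (_ : Algebra k L₁) (_ : Algebra k L₂),
      FiniteDimensional k L₁ ∧ FiniteDimensional k L₂ ∧
      Algebra.IsCentral k L₁ ∧ Algebra.IsCentral k L₂ ∧
      ∃ e : A ≃ₐ[k] Matrix (Fin m₁) (Fin m₁) L₁ × Matrix (Fin m₂) (Fin m₂) L₂,
        e y₁ = (1, 0) ∧ e y₂ = (0, 1) := by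
  obtain ⟨n, D, d, _, _, hfin, hd, ⟨φ⟩⟩ :=
    IsSemisimpleRing.exists_algEquiv_pi_matrix_divisionRing_finite k A
  have hadd' (i) : φ y₁ i + φ y₂ i = 1 := by
    rw [← Pi.add_apply, ← map_add, hadd, map_one, Pi.one_apply]
  have hmul' (i) : φ y₁ i * φ y₂ i = 0 := by
    rw [← Pi.mul_apply, ← map_mul, hmul, map_zero, Pi.zero_apply]
  have hcomm {y : A} (hy : ∀ x, y * x = x * y) (i) (M : Matrix (Fin (d i)) (Fin (d i)) (D i)) :
      M * φ y i = φ y i * M := by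
    have := congrFun (congrArg φ (hy (φ.symm (Pi.single i M)))) i
    simpa using this.symm
  -- The centre of a simple ring is a field, so two central elements with product zero cannot both
  -- be non-zero in a block.
  have hzero (i) : φ y₁ i = 0 ∨ φ y₂ i = 0 := by
    have hF := IsSimpleRing.isField_center (Matrix (Fin (d i)) (Fin (d i)) (D i))
    let := hF.toField
    have : (⟨φ y₁ i, Subring.mem_center_iff.mpr (hcomm hc₁ i)⟩ : Subring.center _) *
        ⟨φ y₂ i, Subring.mem_center_iff.mpr (hcomm hc₂ i)⟩ = 0 := Subtype.ext (hmul' i)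
    exact (mul_eq_zero.mp this).imp (congrArg Subtype.val) (congrArg Subtype.val)
  have hex {y : A} (hy : y ≠ 0) : ∃ i, φ y i ≠ 0 := by
    by_contra! hcon
    exact hy (φ.injective (by rw [map_zero]; exact funext hcon))
  obtain ⟨i, hi⟩ := hex h₁
  obtain ⟨j, hj⟩ := hex h₂
  have hi2 : φ y₂ i = 0 := (hzero i).resolve_left hi
  have hj1 : φ y₁ j = 0 := (hzero j).resolve_right hj
  have hi1 : φ y₁ i = 1 := by simpa [hi2] using hadd' i
  have hj2 : φ y₂ j = 1 := by simpa [hj1] using hadd' j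
  have hij : i ≠ j := by rintro rfl; exact hi hj1
  -- A central scalar placed in one block is central in the whole product, so the spanning
  -- hypothesis applies to it.
  have hcoord (l) (c : D l) (hc : ∀ x, x * c = c * x) :
      ∃ r s : k, Pi.single l (Matrix.scalar (Fin (d l)) c) = r • φ y₁ + s • φ y₂ := by
    obtain ⟨r, s, hrs⟩ := hcent (φ.symm (Pi.single l (Matrix.scalar (Fin (d l)) c))) fun y => by
      apply φ.injective
      rw [map_mul, map_mul, AlgEquiv.apply_symm_apply]
      funext l'
      by_cases hl : l' = l
      · subst hl
        simp only [Pi.mul_apply, Pi.single_eq_same]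
        exact ((Matrix.scalar_commute c (fun x => (hc x).symm) (φ y l')).eq).symm
      · simp [Pi.single_eq_of_ne hl]
    refine ⟨r, s, ?_⟩
    rw [← map_smul, ← map_smul, ← map_add, ← hrs, AlgEquiv.apply_symm_apply]
  -- Comparing a matrix entry in a block where one idempotent is `1` and the other `0` shows that
  -- `c` comes from `k`.
  have hcentral (l) (hl : l = i ∨ l = j) : Algebra.IsCentral k (D l) := ⟨fun c hc => by
    rw [Subalgebra.mem_center_iff] at hc
    obtain ⟨r, s, hrs⟩ := hcoord l c hc
    have h3 := congrFun (congrFun (congrFun hrs l) 0) 0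
    rw [Algebra.mem_bot]
    rcases hl with rfl | rfl
    · exact ⟨r, by simpa [hi1, hi2, Algebra.algebraMap_eq_smul_one] using h3.symm⟩
    · exact ⟨s, by simpa [hj1, hj2, Algebra.algebraMap_eq_smul_one] using h3.symm⟩⟩
  have hone (l) : ∃ r s : k, Pi.single l (1 : Matrix (Fin (d l)) (Fin (d l)) (D l)) =
      r • φ y₁ + s • φ y₂ := by simpa using hcoord l 1 (by simp)
  -- The unit of block `i` is `r y₁ + s y₂`; its `j`-component forces `s = 0` and its `i`-component
  -- `r = 1`.
  have hy₁ : φ y₁ = Pi.single i 1 := by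
    obtain ⟨r, s, hrs⟩ := hone i
    have e1 := congrFun hrs i
    have e2 := congrFun hrs j
    simp only [Pi.single_eq_same, Pi.add_apply, Pi.smul_apply, hi1, hi2, hj1, hj2, smul_zero,
      add_zero, zero_add, Pi.single_eq_of_ne hij.symm] at e1 e2
    have hs : s = 0 := by simpa using e2.symm
    rw [hrs, hs, zero_smul, add_zero]
    have h4 : (r - 1) • (1 : Matrix (Fin (d i)) (Fin (d i)) (D i)) = 0 := by
      rw [sub_smul, one_smul, ← e1, sub_self]
    have hr : r = 1 := by simpa [sub_eq_zero] using h4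
    rw [hr, one_smul]
  have hy₂ : φ y₂ = Pi.single j 1 := by
    obtain ⟨r, s, hrs⟩ := hone j
    have e1 := congrFun hrs j
    have e2 := congrFun hrs i
    simp only [Pi.single_eq_same, Pi.add_apply, Pi.smul_apply, hi1, hi2, hj1, hj2, smul_zero,
      add_zero, zero_add, Pi.single_eq_of_ne hij] at e1 e2
    have hr : r = 0 := by simpa using e2.symm
    rw [hrs, hr, zero_smul, zero_add]
    have h4 : (s - 1) • (1 : Matrix (Fin (d j)) (Fin (d j)) (D j)) = 0 := by
      rw [sub_smul, one_smul, ← e1, sub_self]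
    have hs : s = 1 := by simpa [sub_eq_zero] using h4
    rw [hs, one_smul]
  -- In any third block both idempotents would vanish, although they add up to `1`.
  have hall (l) : l = i ∨ l = j := by
    by_contra! hcon
    have := hadd' l
    rw [hy₁, hy₂, Pi.single_eq_of_ne hcon.1, Pi.single_eq_of_ne hcon.2, add_zero] at this
    exact zero_ne_one this
  let π : (Π l, Matrix (Fin (d l)) (Fin (d l)) (D l)) →ₐ[k]
      Matrix (Fin (d i)) (Fin (d i)) (D i) × Matrix (Fin (d j)) (Fin (d j)) (D j) :=
    (Pi.evalAlgHom k _ i).prod (Pi.evalAlgHom k _ j)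
  have hπ : Function.Bijective π := by
    constructor
    · intro x y hxy
      funext l
      rcases hall l with rfl | rfl
      · exact congrArg Prod.fst hxy
      · exact congrArg Prod.snd hxy
    · rintro ⟨x, y⟩
      refine ⟨Pi.single i x + Pi.single j y, ?_⟩
      simp [π, Pi.single_eq_of_ne hij, Pi.single_eq_of_ne hij.symm]
  refine ⟨d i, d j, D i, D j, inferInstance, inferInstance, inferInstance, inferInstance,
    hfin i, hfin j, hcentral i (.inl rfl), hcentral j (.inr rfl),
    φ.trans (AlgEquiv.ofBijective π hπ), ?_, ?_⟩
  · simp [π, hi1, hj1]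
  · simp [π, hi2, hj2]

variable {B₁ B₂ : Type w} [Ring B₁] [Ring B₂] [Algebra k B₁] [Algebra k B₂]

/-- Multiplication by `(1, 0)` is the projection onto the first factor. -/
theorem trace_mulLeft_symm_inl [FiniteDimensional k B₁] [FiniteDimensional k B₂]
    (e : A ≃ₐ[k] B₁ × B₂) :
    LinearMap.trace k A (LinearMap.mulLeft k (e.symm (1, 0))) = Module.finrank k B₁ := by
  have h1 : e.toLinearEquiv.conj (LinearMap.mulLeft k (e.symm (1, 0))) =
      LinearMap.prodMap LinearMap.id 0 := by
    ext x <;> simp [LinearEquiv.conj_apply]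
  rw [← LinearMap.trace_conj' _ e.toLinearEquiv, h1, LinearMap.trace_prodMap', map_zero, add_zero,
    LinearMap.trace_id]

theorem trace_mulLeft_symm_inr [FiniteDimensional k B₁] [FiniteDimensional k B₂]
    (e : A ≃ₐ[k] B₁ × B₂) :
    LinearMap.trace k A (LinearMap.mulLeft k (e.symm (0, 1))) = Module.finrank k B₂ := by
  have h1 : e.toLinearEquiv.conj (LinearMap.mulLeft k (e.symm (0, 1))) =
      LinearMap.prodMap 0 LinearMap.id := by
    ext x <;> simp [LinearEquiv.conj_apply]
  rw [← LinearMap.trace_conj' _ e.toLinearEquiv, h1, LinearMap.trace_prodMap', map_zero, zero_add,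
    LinearMap.trace_id]

end Wedderburn

/-! ### Dimensions and idempotents of a decomposition -/

namespace SkewDecomposition

variable {k : Type u} {A : Type v} [Field k] [Ring A] [Algebra k A] (D : SkewDecomposition k A)

theorem finrank_fst :
    Module.finrank k (Matrix (Fin D.m₁) (Fin D.m₁) k ⊗[k] D.L₁) = D.d₁ := by
  rw [Module.finrank_tensorProduct, Module.finrank_matrix, d₁]; simp [pow_two]

theorem finrank_snd :
    Module.finrank k (Matrix (Fin D.m₂) (Fin D.m₂) k ⊗[k] D.L₂) = D.d₂ := by
  rw [Module.finrank_tensorProduct, Module.finrank_matrix, d₂]; simp [pow_two]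

theorem finrank_eq : Module.finrank k A = D.d₁ + D.d₂ := by
  rw [D.equiv.toLinearEquiv.finrank_eq, Module.finrank_prod, D.finrank_fst, D.finrank_snd]

theorem z₁_add_z₂ : D.z₁ + D.z₂ = 1 := by
  rw [z₁, z₂, ← map_add, ← map_one D.equiv.symm]
  simp [Algebra.TensorProduct.one_def, Prod.one_eq_mk]

theorem z₁_mul_z₂ : D.z₁ * D.z₂ = 0 := by
  rw [z₁, z₂, ← map_mul]; simp

theorem z₁_ne_zero (h : D.d₁ ≠ 0) : D.z₁ ≠ 0 := by
  have : Nontrivial (Matrix (Fin D.m₁) (Fin D.m₁) k ⊗[k] D.L₁) :=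
    Module.nontrivial_of_finrank_pos (R := k) (by rw [D.finrank_fst]; omega)
  rw [z₁, Ne, EmbeddingLike.map_eq_zero_iff, Prod.mk_eq_zero, ← Algebra.TensorProduct.one_def]
  simp

theorem z₂_ne_zero (h : D.d₂ ≠ 0) : D.z₂ ≠ 0 := by
  have : Nontrivial (Matrix (Fin D.m₂) (Fin D.m₂) k ⊗[k] D.L₂) :=
    Module.nontrivial_of_finrank_pos (R := k) (by rw [D.finrank_snd]; omega)
  rw [z₂, Ne, EmbeddingLike.map_eq_zero_iff, Prod.mk_eq_zero, ← Algebra.TensorProduct.one_def]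
  simp

end SkewDecomposition

/-! ### The form of the window element -/

namespace KnowledgeableFrobenius.IsStateSum

variable {k : Type u} {A : Type v} [Field k] [Ring A] [Algebra k A] [Coalgebra k A] {h t α β : k}
  {K : KnowledgeableFrobenius k A (FrobC h t)}

theorem exists_window_eq (hK : K.IsStateSum) (hne : α ≠ β) :
    ∃ ξ₁ ξ₂ : k, windowElement k A =
      ξ₁ • K.incl (frobIdem h t α β) + ξ₂ • K.incl (frobIdem h t β α) := by
  obtain ⟨r, s, hrs⟩ := frobC_exists_eq_frobIdem hne (K.coincl 1)
  exact ⟨r, s, by rw [← hK.incl_coincl_one, hrs, map_add, map_smul, map_smul]⟩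

/-- Put `y = ι(e)`. As `a` acts on `y` by `ξ₁`, the counit condition gives `ξ₁ = (α - β) ε(y)`, and
the trace formula gives `tr L_y = ξ₁ ε(y)`. Exchanging `α` and `β` yields the statement for the
other idempotent. -/
theorem window_scalar (hK : K.IsStateSum) (hne : α ≠ β) (h1 : α + β = h) (h2 : α * β = -t)
    {ξ₁ ξ₂ : k} (ha : windowElement k A =
      ξ₁ • K.incl (frobIdem h t α β) + ξ₂ • K.incl (frobIdem h t β α)) :
    ξ₁ ≠ 0 ∧ ξ₁ ^ 2 = (α - β) *
      LinearMap.trace k A (LinearMap.mulLeft k (K.incl (frobIdem h t α β))) := by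
  have := hK.stronglySeparable.1
  set y := K.incl (frobIdem h t α β) with hy
  have hy0 : y ≠ 0 := fun h0 =>
    frobIdem_ne_zero hne (hK.incl_injective (by rw [map_zero, ← h0, hy]))
  have hya : y * windowElement k A = ξ₁ • y := by
    rw [ha, mul_add, mul_smul_comm, mul_smul_comm, hy, ← map_mul, ← map_mul,
      frobIdem_mul_self hne h1 h2, frobIdem_mul h1 h2, map_zero, smul_zero, add_zero]
  have hξ : ξ₁ ≠ 0 := by
    rintro rfl
    rw [zero_smul] at hya
    exact hy0 ((hK.isUnit_window.mul_left_eq_zero).mp hya)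
  refine ⟨hξ, ?_⟩
  have hinv : Ring.inverse (windowElement k A) * y = ξ₁⁻¹ • y := by
    have e : y = windowElement k A * (ξ₁⁻¹ • y) := by
      rw [mul_smul_comm, hK.mul_comm_window, hya, smul_smul, inv_mul_cancel₀ hξ, one_smul]
    conv_lhs => rw [e, ← mul_assoc, Ring.inverse_mul_cancel _ hK.isUnit_window, one_mul]
  have e1 := hK.counit_eq (frobIdem h t α β)
  rw [counit_frobIdem, ← hy, hinv, map_smul, smul_eq_mul] at e1
  rw [K.symmetric_A.trace_mulLeft, hya, map_smul, smul_eq_mul]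
  have h3 : α - β ≠ 0 := sub_ne_zero.mpr hne
  have e2 : ξ₁ = (α - β) * Coalgebra.counit (R := k) y := by
    field_simp at e1
    exact e1
  rw [pow_two]
  nth_rewrite 2 [e2]
  ring

theorem exists_skewDecomposition (hK : K.IsStateSum) (hne : α ≠ β) (h1 : α + β = h)
    (h2 : α * β = -t) :
    ∃ D : SkewDecomposition k A, D.HasWindowForm (windowElement k A) α β := by
  have := hK.stronglySeparable.1
  have := hK.stronglySeparable.isSemisimpleRing
  have h1' : β + α = h := by rw [add_comm, h1]
  have h2' : β * α = -t := by rw [mul_comm, h2]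
  obtain ⟨m₁, m₂, L₁, L₂, _, _, _, _, _, _, _, _, e, he₁, he₂⟩ :=
    exists_algEquiv_prod_matrix (k := k) (y₁ := K.incl (frobIdem h t α β))
      (y₂ := K.incl (frobIdem h t β α))
      (by rw [← map_add, frobIdem_add hne, map_one])
      (by rw [← map_mul, frobIdem_mul h1 h2, map_zero])
      (fun h0 => frobIdem_ne_zero hne (hK.incl_injective (by rw [map_zero, h0])))
      (fun h0 => frobIdem_ne_zero hne.symm (hK.incl_injective (by rw [map_zero, h0])))
      (K.knowledge _) (K.knowledge _)
      (fun x hx => by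
        obtain ⟨c, rfl⟩ := hK.exists_incl_eq hx
        obtain ⟨r, s, rfl⟩ := frobC_exists_eq_frobIdem hne c
        exact ⟨r, s, by rw [map_add, map_smul, map_smul]⟩)
  obtain ⟨ξ₁, ξ₂, ha⟩ := hK.exists_window_eq (α := α) (β := β) hne
  obtain ⟨hξ₁, hs₁⟩ := hK.window_scalar hne h1 h2 ha
  obtain ⟨hξ₂, hs₂⟩ := hK.window_scalar hne.symm h1' h2' (ha.trans (add_comm _ _))
  rw [← e.symm_apply_apply (K.incl _), he₁, trace_mulLeft_symm_inl, Module.finrank_matrix] at hs₁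
  rw [← e.symm_apply_apply (K.incl _), he₂, trace_mulLeft_symm_inr, Module.finrank_matrix] at hs₂
  simp only [Fintype.card_fin, Nat.cast_mul] at hs₁ hs₂
  -- Since `ξ₁²` is a multiple of `m₁² dim L₁`, neither factor vanishes in `k`. This yields the
  -- divisibility conditions and the strong separability of `L₁`.
  have hn₁ := hs₁ ▸ pow_ne_zero 2 hξ₁
  have hn₂ := hs₂ ▸ pow_ne_zero 2 hξ₂
  have hL₁ := right_ne_zero_of_mul (right_ne_zero_of_mul hn₁)
  have hL₂ := right_ne_zero_of_mul (right_ne_zero_of_mul hn₂)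
  have hm₁ := left_ne_zero_of_mul (left_ne_zero_of_mul (right_ne_zero_of_mul hn₁))
  have hm₂ := left_ne_zero_of_mul (left_ne_zero_of_mul (right_ne_zero_of_mul hn₂))
  let f₁ := (matrixEquivTensor (Fin m₁) k L₁).trans (Algebra.TensorProduct.comm k L₁ _)
  let f₂ := (matrixEquivTensor (Fin m₂) k L₂).trans (Algebra.TensorProduct.comm k L₂ _)
  let D : SkewDecomposition k A :=
    { m₁ := m₁
      m₂ := m₂
      L₁ := L₁
      L₂ := L₂
      stronglySeparable₁ := isStronglySeparable_of_finrank_ne_zero hL₁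
      stronglySeparable₂ := isStronglySeparable_of_finrank_ne_zero hL₂
      not_dvd_m₁ := by rwa [← ringChar.spec]
      not_dvd_m₂ := by rwa [← ringChar.spec]
      not_dvd_dim₁ := by rwa [← ringChar.spec]
      not_dvd_dim₂ := by rwa [← ringChar.spec]
      equiv := e.trans (AlgEquiv.prodCongr f₁ f₂) }
  have hz₁ : D.z₁ = K.incl (frobIdem h t α β) := by
    rw [SkewDecomposition.z₁, AlgEquiv.symm_apply_eq]
    change _ = (AlgEquiv.prodCongr f₁ f₂) (e _)
    rw [he₁]
    change _ = (f₁ 1, f₂ 0)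
    rw [map_one, map_zero]; rfl
  have hz₂ : D.z₂ = K.incl (frobIdem h t β α) := by
    rw [SkewDecomposition.z₂, AlgEquiv.symm_apply_eq]
    change _ = (AlgEquiv.prodCongr f₁ f₂) (e _)
    rw [he₂]
    change _ = (f₁ 0, f₂ 1)
    rw [map_one, map_zero]; rfl
  refine ⟨D, ξ₁, ξ₂, hξ₁, hξ₂, by rw [hz₁, hz₂, ha], ?_, ?_⟩
  · rw [hs₁]; simp only [SkewDecomposition.d₁, D]; push_cast; ring
  · rw [hs₂]; simp only [SkewDecomposition.d₂, D]; push_cast; ring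

end KnowledgeableFrobenius.IsStateSum

/-! ### Generalities on filtrations -/

section Filtration

variable {k : Type u} [Field k] {V : Type v} {W : Type w} [AddCommGroup V] [Module k V]
  [AddCommGroup W] [Module k W] {F : ℤ → Submodule k V} {G : ℤ → Submodule k W}

theorem IsBoundedFiltration.antitone (hF : IsBoundedFiltration F) : Antitone F :=
  antitone_int_of_succ_le hF.anti

theorem tmul_mem_tensorFiltration {p q j : ℤ} {x : V} {y : W} (hx : x ∈ F p) (hy : y ∈ G q)
    (hj : j ≤ p + q) : x ⊗ₜ[k] y ∈ tensorFiltration F G j :=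
  Submodule.subset_span ⟨p, q, hj, x, hx, y, hy, rfl⟩

theorem tensorFiltration_eq_top {p q j : ℤ} (hF : F p = ⊤) (hG : G q = ⊤) (hj : j ≤ p + q) :
    tensorFiltration F G j = ⊤ := by
  rw [eq_top_iff, ← TensorProduct.span_tmul_eq_top, Submodule.span_le]
  rintro _ ⟨x, y, rfl⟩
  exact tmul_mem_tensorFiltration (hF ▸ Submodule.mem_top) (hG ▸ Submodule.mem_top) hj

/-- Pure tensors of homogeneous bounds span the tensor filtration, and `H` is decreasing, so the
bound on them suffices. -/
theorem IsFilteredOfDegree.of_tmul {U : Type*} [AddCommGroup U] [Module k U]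
    {H : ℤ → Submodule k U} (hH : Antitone H) {f : V ⊗[k] W →ₗ[k] U} {l : ℤ}
    (hf : ∀ p q, ∀ x ∈ F p, ∀ y ∈ G q, f (x ⊗ₜ y) ∈ H (p + q + l)) :
    IsFilteredOfDegree (tensorFiltration F G) H f l := by
  intro j z hz
  have : tensorFiltration F G j ≤ (H (j + l)).comap f := by
    refine Submodule.span_le.mpr ?_
    rintro _ ⟨p, q, hj, x, hx, y, hy, rfl⟩
    exact hH (by omega) (hf p q x hx y hy)
  exact this hz

theorem isFilteredOfDegree_fieldFiltration {f : k →ₗ[k] V} {l : ℤ} (hF : Antitone F)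
    (h1 : f 1 ∈ F l) : IsFilteredOfDegree (fieldFiltration k) F f l := by
  intro j x hx
  by_cases hj : j ≤ 0
  · have : f x = x • f 1 := by rw [← map_smul, smul_eq_mul, mul_one]
    rw [this]
    exact Submodule.smul_mem _ _ (hF (by omega) h1)
  · rw [fieldFiltration, if_neg hj, Submodule.mem_bot] at hx
    rw [hx, map_zero]; exact zero_mem _

end Filtration

/-! ### The filtration of `A` -/

section OpenFiltration

variable {k : Type u} {A : Type v} [Field k] [Ring A] [Algebra k A] [Coalgebra k A]

variable (k A) in
/-- The filtration `A ⊇ ker ε ⊇ k ⊇ 0` in degrees `-1`, `0`, `1`, `2`. -/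
def openFiltration (j : ℤ) : Submodule k A :=
  if j ≤ -1 then ⊤ else if j ≤ 0 then LinearMap.ker (Coalgebra.counit (R := k) (A := A))
    else if j ≤ 1 then Submodule.span k {1} else ⊥

theorem openFiltration_eq_top {j : ℤ} (hj : j ≤ -1) : openFiltration k A j = ⊤ := if_pos hj

theorem mem_openFiltration_cases {j : ℤ} {x : A} (hx : x ∈ openFiltration k A j) :
    j ≤ -1 ∨ (j ≤ 0 ∧ Coalgebra.counit (R := k) x = 0) ∨ (j ≤ 1 ∧ ∃ r : k, r • 1 = x) ∨ x = 0 := by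
  unfold openFiltration at hx
  split_ifs at hx with h1 h2 h3
  · exact .inl h1
  · exact .inr (.inl ⟨h2, hx⟩)
  · exact .inr (.inr (.inl ⟨h3, Submodule.mem_span_singleton.mp hx⟩))
  · exact .inr (.inr (.inr hx))

theorem mem_openFiltration_of_top {j : ℤ} (x : A) (hj : j ≤ -1) : x ∈ openFiltration k A j := by
  rw [openFiltration_eq_top hj]; trivial

theorem mem_openFiltration_of_counit {j : ℤ} {x : A} (hj : j ≤ 0)
    (hx : Coalgebra.counit (R := k) x = 0) : x ∈ openFiltration k A j := by
  unfold openFiltration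
  split_ifs
  · trivial
  · exact hx

theorem smul_one_mem_openFiltration (h1 : Coalgebra.counit (R := k) (1 : A) = 0) {j : ℤ} (r : k)
    (hj : j ≤ 1) : r • (1 : A) ∈ openFiltration k A j := by
  unfold openFiltration
  split_ifs
  · trivial
  · simp [h1]
  · exact Submodule.smul_mem _ _ (Submodule.mem_span_singleton_self 1)

theorem isBoundedFiltration_openFiltration (h1 : Coalgebra.counit (R := k) (1 : A) = 0) :
    IsBoundedFiltration (openFiltration k A) where
  anti j := fun x hx => by
    rcases mem_openFiltration_cases hx with hj | ⟨hj, hx⟩ | ⟨hj, r, rfl⟩ | rfl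
    · exact mem_openFiltration_of_top _ (by omega)
    · exact mem_openFiltration_of_counit (by omega) hx
    · exact smul_one_mem_openFiltration h1 r (by omega)
    · exact zero_mem _
  exists_eq_top := ⟨-1, openFiltration_eq_top le_rfl⟩
  exists_eq_bot := ⟨2, by simp [openFiltration]⟩

/-- If both degrees are at most `0`, the target degree is at most `-1` and nothing is to be shown;
otherwise a factor is a scalar, of degree `1`, which compensates the shift. -/
theorem isFilteredOfDegree_mul_openFiltration (h1 : Coalgebra.counit (R := k) (1 : A) = 0) :
    IsFilteredOfDegree (tensorFiltration (openFiltration k A) (openFiltration k A))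
      (openFiltration k A) (LinearMap.mul' k A) (-1) := by
  have ha := (isBoundedFiltration_openFiltration h1).antitone
  refine .of_tmul ha fun p q x hx y hy => ?_
  rw [LinearMap.mul'_apply]
  by_cases hx' : p ≤ 0
  · by_cases hy' : q ≤ 0
    · exact mem_openFiltration_of_top _ (by omega)
    · rcases mem_openFiltration_cases hy with hj | ⟨hj, -⟩ | ⟨hj, r, rfl⟩ | rfl
      · omega
      · omega
      · rw [mul_smul_comm, mul_one]
        exact Submodule.smul_mem _ _ (ha (by omega) hx)
      · rw [mul_zero]; exact zero_mem _
  · rcases mem_openFiltration_cases hx with hj | ⟨hj, -⟩ | ⟨hj, r, rfl⟩ | rfl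
    · omega
    · omega
    · rw [smul_mul_assoc, one_mul]
      exact Submodule.smul_mem _ _ (ha (by omega) hy)
    · rw [zero_mul]; exact zero_mem _

variable (k) in
/-- The map `x ↦ x - ε(x) u`, which projects `A` onto `ker ε` if `ε(u) = 1`. -/
def counitProj (u : A) : A →ₗ[k] A :=
  LinearMap.id - (Coalgebra.counit (R := k) (A := A)).smulRight u

/-- The decomposition of `Δ(x)` with respect to `A = ker ε ⊕ k u`. -/
theorem comul_eq_map_add {u : A} (x : A) :
    Coalgebra.comul (R := k) x =
      TensorProduct.map (counitProj k u) (counitProj k u) (Coalgebra.comul (R := k) x) +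
        x ⊗ₜ u + u ⊗ₜ x - Coalgebra.counit (R := k) x • u ⊗ₜ[k] u := by
  obtain ⟨S, hS⟩ := TensorProduct.exists_finset (Coalgebra.comul (R := k) x)
  have hl : ∑ i ∈ S, Coalgebra.counit (R := k) i.1 • i.2 = x := by
    have := congrArg (TensorProduct.lid k A)
      (LinearMap.congr_fun (Coalgebra.rTensor_counit_comp_comul (R := k) (A := A)) x)
    rw [LinearMap.comp_apply, hS] at this
    simpa using this
  have hr : ∑ i ∈ S, Coalgebra.counit (R := k) i.2 • i.1 = x := by
    have := congrArg (TensorProduct.rid k A)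
      (LinearMap.congr_fun (Coalgebra.lTensor_counit_comp_comul (R := k) (A := A)) x)
    rw [LinearMap.comp_apply, hS] at this
    simpa using this
  have hc : ∑ i ∈ S, Coalgebra.counit (R := k) i.1 * Coalgebra.counit (R := k) i.2 =
      Coalgebra.counit (R := k) x := by
    have := congrArg (Coalgebra.counit (R := k)) hl
    simpa [map_sum] using this
  have e1 : x ⊗ₜ[k] u = ∑ i ∈ S, (Coalgebra.counit (R := k) i.2 • i.1) ⊗ₜ[k] u := by
    rw [← TensorProduct.sum_tmul, hr]
  have e2 : u ⊗ₜ[k] x = ∑ i ∈ S, u ⊗ₜ[k] (Coalgebra.counit (R := k) i.1 • i.2) := by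
    rw [← TensorProduct.tmul_sum, hl]
  rw [hS, map_sum, e1, e2, ← hc, Finset.sum_smul, ← Finset.sum_add_distrib,
    ← Finset.sum_add_distrib, ← Finset.sum_sub_distrib]
  refine Finset.sum_congr rfl fun i _ => ?_
  simp only [counitProj, TensorProduct.map_tmul, LinearMap.sub_apply, LinearMap.id_apply,
    LinearMap.smulRight_apply, TensorProduct.sub_tmul, TensorProduct.tmul_sub,
    ← TensorProduct.smul_tmul', TensorProduct.tmul_smul]
  module

theorem isFilteredOfDegree_comul_openFiltration [Nontrivial A]
    (h1 : Coalgebra.counit (R := k) (1 : A) = 0) :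
    IsFilteredOfDegree (openFiltration k A)
      (tensorFiltration (openFiltration k A) (openFiltration k A))
      (Coalgebra.comul (R := k) (A := A)) (-1) := by
  -- The counit is non-zero, since `(ε ⊗ id) ∘ Δ` recovers `1 ≠ 0`; `u` spans a complement of `ker
  -- ε`.
  obtain ⟨u, hu⟩ : ∃ u : A, Coalgebra.counit (R := k) u = 1 := by
    by_contra! hcon
    have hz : Coalgebra.counit (R := k) (A := A) = 0 := by
      ext x
      by_contra hx
      exact hcon ((Coalgebra.counit (R := k) x)⁻¹ • x) (by
        rw [map_smul, smul_eq_mul, inv_mul_cancel₀ hx])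
    have := congrArg (TensorProduct.lid k A)
      (LinearMap.congr_fun (Coalgebra.rTensor_counit_comp_comul (R := k) (A := A)) 1)
    simp [hz] at this
  have hu' : u ∈ openFiltration k A (-1) := mem_openFiltration_of_top _ le_rfl
  have hP (y : A) : Coalgebra.counit (R := k) (counitProj k u y) = 0 := by
    simp [counitProj, hu]
  have hPP (z : A ⊗[k] A) {j : ℤ} (hj : j ≤ 0) :
      TensorProduct.map (counitProj k u) (counitProj k u) z ∈
      tensorFiltration (openFiltration k A) (openFiltration k A) j := by
    induction z with
    | zero => rw [map_zero]; exact zero_mem _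
    | tmul a b =>
      rw [TensorProduct.map_tmul]
      exact tmul_mem_tensorFiltration (mem_openFiltration_of_counit le_rfl (hP a))
        (mem_openFiltration_of_counit le_rfl (hP b)) (by omega)
    | add a b ha hb => rw [map_add]; exact add_mem ha hb
  -- For `ε(x) = 0` the `u ⊗ u` term, of degree only `-2`, disappears. The `ker ε ⊗ ker ε` part has
  -- degree `0 ≥ j - 1`, and pairing `x` with `u` costs exactly `1`.
  have key (j : ℤ) (hj : j ≤ 1) (x : A) (hx : x ∈ openFiltration k A j)
      (hx0 : Coalgebra.counit (R := k) x = 0) : Coalgebra.comul (R := k) x ∈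
        tensorFiltration (openFiltration k A) (openFiltration k A) (j + -1) := by
    rw [comul_eq_map_add (u := u) x, hx0, zero_smul, sub_zero]
    exact add_mem (add_mem (hPP _ (by omega)) (tmul_mem_tensorFiltration hx hu' le_rfl))
      (tmul_mem_tensorFiltration hu' hx (by omega))
  intro j x hx
  rcases mem_openFiltration_cases hx with hj | ⟨hj, hx'⟩ | ⟨hj, r, rfl⟩ | rfl
  · rw [tensorFiltration_eq_top (openFiltration_eq_top le_rfl) (openFiltration_eq_top le_rfl)
      (by omega)]
    trivial
  · exact key j (by omega) x hx hx'
  · exact key j hj _ hx (by rw [map_smul, h1, smul_zero])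
  · rw [map_zero]; exact zero_mem _

theorem isFilteredOfDegree_counit_openFiltration (h1 : Coalgebra.counit (R := k) (1 : A) = 0) :
    IsFilteredOfDegree (openFiltration k A) (fieldFiltration k)
      (Coalgebra.counit (R := k) (A := A)) 1 := by
  intro j x hx
  rcases mem_openFiltration_cases hx with hj | ⟨hj, hx'⟩ | ⟨hj, r, rfl⟩ | rfl
  · rw [fieldFiltration, if_pos (by omega)]; trivial
  · rw [hx']; exact zero_mem _
  · rw [map_smul, h1, smul_zero]; exact zero_mem _
  · rw [map_zero]; exact zero_mem _

end OpenFiltration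

/-! ### The filtration of `C_{h,t}` -/

section ClosedFiltration

variable {k : Type u} [Field k] (h t : k)

/-- The filtration `C ⊇ k ⊇ 0` in degrees `-2`, `2`, `3`. -/
def closedFiltration (j : ℤ) : Submodule k (FrobC h t) :=
  if j ≤ -2 then ⊤ else if j ≤ 2 then Submodule.span k {1} else ⊥

variable {h t}

theorem closedFiltration_eq_top {j : ℤ} (hj : j ≤ -2) : closedFiltration h t j = ⊤ := if_pos hj

theorem mem_closedFiltration_cases {j : ℤ} {x : FrobC h t} (hx : x ∈ closedFiltration h t j) :
    j ≤ -2 ∨ (j ≤ 2 ∧ ∃ r : k, r • 1 = x) ∨ x = 0 := by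
  unfold closedFiltration at hx
  split_ifs at hx with h1 h2
  · exact .inl h1
  · exact .inr (.inl ⟨h2, Submodule.mem_span_singleton.mp hx⟩)
  · exact .inr (.inr hx)

theorem mem_closedFiltration_of_top {j : ℤ} (x : FrobC h t) (hj : j ≤ -2) :
    x ∈ closedFiltration h t j := by
  rw [closedFiltration_eq_top hj]; trivial

theorem one_mem_closedFiltration {j : ℤ} (hj : j ≤ 2) :
    (1 : FrobC h t) ∈ closedFiltration h t j := by
  unfold closedFiltration
  split_ifs
  · trivial
  · exact Submodule.mem_span_singleton_self 1

variable (h t) in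
theorem isBoundedFiltration_closedFiltration : IsBoundedFiltration (closedFiltration h t) where
  anti j := fun x hx => by
    rcases mem_closedFiltration_cases hx with hj | ⟨hj, r, rfl⟩ | rfl
    · exact mem_closedFiltration_of_top _ (by omega)
    · exact Submodule.smul_mem _ _ (one_mem_closedFiltration (by omega))
    · exact zero_mem _
  exists_eq_top := ⟨-2, closedFiltration_eq_top le_rfl⟩
  exists_eq_bot := ⟨3, by simp [closedFiltration]⟩

variable (h t) in
theorem isFilteredOfDegree_mul_closedFiltration :
    IsFilteredOfDegree (tensorFiltration (closedFiltration h t) (closedFiltration h t))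
      (closedFiltration h t) (LinearMap.mul' k (FrobC h t)) (-2) := by
  have ha := (isBoundedFiltration_closedFiltration h t).antitone
  refine .of_tmul ha fun p q x hx y hy => ?_
  rw [LinearMap.mul'_apply]
  rcases mem_closedFiltration_cases hx with hp | ⟨hp, r, rfl⟩ | rfl
  · rcases mem_closedFiltration_cases hy with hq | ⟨hq, r, rfl⟩ | rfl
    · exact mem_closedFiltration_of_top _ (by omega)
    · rw [mul_smul_comm, mul_one]
      exact Submodule.smul_mem _ _ (ha (by omega) hx)
    · rw [mul_zero]; exact zero_mem _
  · rw [smul_mul_assoc, one_mul]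
    exact Submodule.smul_mem _ _ (ha (by omega) hy)
  · rw [zero_mul]; exact zero_mem _

variable (h t) in
theorem isFilteredOfDegree_comul_closedFiltration :
    IsFilteredOfDegree (closedFiltration h t)
      (tensorFiltration (closedFiltration h t) (closedFiltration h t))
      (Coalgebra.comul (R := k) (A := FrobC h t)) (-2) := by
  -- The bound is `0 = 2 - 2`, from the terms `1 ⊗ x` and `x ⊗ 1`.
  have h1 {j : ℤ} (hj : j ≤ 0) : Coalgebra.comul (R := k) (1 : FrobC h t) ∈
      tensorFiltration (closedFiltration h t) (closedFiltration h t) j := by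
    have e1 : (1 : FrobC h t) ∈ closedFiltration h t 2 := one_mem_closedFiltration le_rfl
    have ex : frobX h t ∈ closedFiltration h t (-2) := mem_closedFiltration_of_top _ le_rfl
    change frobComul h t 1 ∈ _
    rw [frobComul_one]
    exact sub_mem (add_mem (tmul_mem_tensorFiltration e1 ex (by omega))
      (tmul_mem_tensorFiltration ex e1 (by omega)))
      (Submodule.smul_mem _ _ (tmul_mem_tensorFiltration e1 e1 (by omega)))
  intro j x hx
  rcases mem_closedFiltration_cases hx with hj | ⟨hj, r, rfl⟩ | rfl
  · rw [tensorFiltration_eq_top (closedFiltration_eq_top le_rfl) (closedFiltration_eq_top le_rfl)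
      (by omega)]
    trivial
  · rw [map_smul]
    exact Submodule.smul_mem _ _ (h1 (by omega))
  · rw [map_zero]; exact zero_mem _

theorem frobC_counit_eq_zero {c : FrobC h t} (hc : Coalgebra.counit (R := k) c = 0) :
    ∃ r : k, c = r • 1 := by
  obtain ⟨r, s, rfl⟩ := frobC_exists_eq c
  rw [frobC_counit_smul_add] at hc
  exact ⟨r, by rw [hc, zero_smul, add_zero]⟩

theorem frobC_counit_one : Coalgebra.counit (R := k) (1 : FrobC h t) = 0 := frobCounit_one h t

variable (h t) in
theorem isFilteredOfDegree_counit_closedFiltration :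
    IsFilteredOfDegree (closedFiltration h t) (fieldFiltration k)
      (Coalgebra.counit (R := k) (A := FrobC h t)) 2 := by
  intro j x hx
  rcases mem_closedFiltration_cases hx with hj | ⟨hj, r, rfl⟩ | rfl
  · rw [fieldFiltration, if_pos (by omega)]; trivial
  · rw [map_smul, frobC_counit_one, smul_zero]; exact zero_mem _
  · rw [map_zero]; exact zero_mem _

variable (h t) in
theorem hasFiltrationDegree_closedFiltration_one :
    HasFiltrationDegree (closedFiltration h t) 1 2 := by
  refine ⟨one_mem_closedFiltration le_rfl, fun j hj => ?_⟩
  rcases mem_closedFiltration_cases hj with hj | ⟨hj, -⟩ | h0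
  · omega
  · exact hj
  · exact absurd h0 frobC_one_ne_zero

variable (h t) in
theorem hasFiltrationDegree_closedFiltration_x :
    HasFiltrationDegree (closedFiltration h t) (frobX h t) (-2) := by
  refine ⟨mem_closedFiltration_of_top (frobX h t) le_rfl, fun j hj => ?_⟩
  have hx : Coalgebra.counit (R := k) (frobX h t) = 1 := frobCounit_x h t
  rcases mem_closedFiltration_cases hj with hj | ⟨-, r, h0⟩ | h0
  · exact hj
  · rw [← h0, map_smul, frobC_counit_one, smul_zero] at hx
    exact absurd hx zero_ne_one
  · rw [h0, map_zero] at hx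
    exact absurd hx zero_ne_one

end ClosedFiltration

/-! ### The criterion for Euler filtrations -/

namespace KnowledgeableFrobenius

variable {k : Type u} {A : Type v} [Field k] [Ring A] [Algebra k A] [Coalgebra k A] {h t : k}
  {K : KnowledgeableFrobenius k A (FrobC h t)}

/-- The degrees of `η_A`, `ι*` and `ε_C` add up to `1 - 1 + 2 > 0`, so `ε_C(ι*(1))` vanishes and
`ι*(1)` lies in `ker ε_C = k·1`. -/
theorem IsEulerFiltered.exists_window_eq_smul_one (hE : K.IsEulerFiltered) (hK : K.IsStateSum) :
    ∃ ξ : k, windowElement k A = ξ • 1 := by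
  obtain ⟨FA, FC, hE⟩ := hE
  have e1 : (1 : A) ∈ FA 1 := by
    simpa using hE.unit_A 0 1 (by rw [fieldFiltration, if_pos le_rfl]; trivial)
  have e2 : K.coincl 1 ∈ FC (-1) := hE.filtration_C.antitone (by norm_num) (hE.coincl 1 1 e1)
  have e3 : Coalgebra.counit (R := k) (K.coincl 1) = 0 := by
    have := hE.counit_C (-1) _ e2
    rwa [fieldFiltration, if_neg (by norm_num), Submodule.mem_bot] at this
  obtain ⟨r, hr⟩ := frobC_counit_eq_zero e3
  exact ⟨r, by rw [← hK.incl_coincl_one, hr, map_smul, map_one]⟩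

/-- What remains beyond the separate filtrations of `A` and `C` is `ι` and `ι*`. Duality with `c =
1` reads `ε_C ∘ ι* = ε_A`, so `ι*` sends `ker ε_A` into `ker ε_C = k·1`, which has degree `2`. -/
theorem IsStateSum.isEulerFiltration (hK : K.IsStateSum) {ξ : k}
    (ha : windowElement k A = ξ • 1) (h1 : Coalgebra.counit (R := k) (1 : A) = 0) :
    K.IsEulerFiltration (openFiltration k A) (closedFiltration h t) := by
  have hA := isBoundedFiltration_openFiltration h1
  have hC := isBoundedFiltration_closedFiltration h t
  have : Nontrivial (FrobC h t) := ⟨1, 0, frobC_one_ne_zero⟩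
  have : Nontrivial A := hK.incl_injective.nontrivial
  refine
    { filtration_A := hA
      filtration_C := hC
      mul_A := isFilteredOfDegree_mul_openFiltration h1
      unit_A := isFilteredOfDegree_fieldFiltration hA.antitone ?_
      comul_A := isFilteredOfDegree_comul_openFiltration h1
      counit_A := isFilteredOfDegree_counit_openFiltration h1
      mul_C := isFilteredOfDegree_mul_closedFiltration h t
      unit_C := isFilteredOfDegree_fieldFiltration hC.antitone ?_
      comul_C := isFilteredOfDegree_comul_closedFiltration h t
      counit_C := isFilteredOfDegree_counit_closedFiltration h t
      incl := ?_
      coincl := ?_ }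
  · simpa using smul_one_mem_openFiltration h1 (1 : k) le_rfl
  · simpa using one_mem_closedFiltration (h := h) (t := t) le_rfl
  · intro j c hc
    rcases mem_closedFiltration_cases hc with hj | ⟨hj, r, rfl⟩ | rfl
    · exact mem_openFiltration_of_top _ (by omega)
    · rw [map_smul, AlgHom.toLinearMap_apply, map_one]
      exact smul_one_mem_openFiltration h1 r (by omega)
    · rw [map_zero]; exact zero_mem _
  · intro j x hx
    rcases mem_openFiltration_cases hx with hj | ⟨hj, hx'⟩ | ⟨hj, r, rfl⟩ | rfl
    · exact mem_closedFiltration_of_top _ (by omega)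
    · have hd := K.duality 1 x
      rw [one_mul, map_one, one_mul, hx'] at hd
      obtain ⟨r, hr⟩ := frobC_counit_eq_zero hd
      rw [hr]
      exact Submodule.smul_mem _ _ (one_mem_closedFiltration (by omega))
    · have h2 : K.coincl 1 = ξ • 1 := hK.incl_injective (by
        rw [hK.incl_coincl_one, ha, map_smul, map_one])
      rw [map_smul, h2]
      exact Submodule.smul_mem _ _ (Submodule.smul_mem _ _ (one_mem_closedFiltration (by omega)))
    · rw [map_zero]; exact zero_mem _

/-- If the window element is the scalar `ξ`, then `ξ ε(1) = dim A`. -/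
theorem IsStateSum.mul_counit_one (hK : K.IsStateSum) {ξ : k}
    (ha : windowElement k A = ξ • 1) :
    ξ * Coalgebra.counit (R := k) (1 : A) = Module.finrank k A := by
  have := hK.stronglySeparable.1
  have e := K.symmetric_A.trace_mulLeft 1
  rw [LinearMap.mulLeft_one, LinearMap.trace_id, one_mul, ha, map_smul, smul_eq_mul] at e
  exact e.symm

end KnowledgeableFrobenius

/-- Multiplying by the orthogonal idempotents `z₁, z₂`, both non-zero, gives `ξ₁ = ξ₂ = ξ`;
subtracting the two formulas for `ξ²` leaves `(α - β)(d₁ + d₂) = 0`. -/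
theorem SkewDecomposition.HasWindowForm.of_eq_smul_one {k : Type u} {A : Type v} [Field k] [Ring A]
    [Algebra k A] {D : SkewDecomposition k A} {a : A} {α β ξ : k} (hD : D.HasWindowForm a α β)
    (ha : a = ξ • 1) (hne : α ≠ β) :
    ξ ≠ 0 ∧ ((D.d₁ + D.d₂ : ℕ) : k) = 0 ∧ ξ ^ 2 = (α - β) * D.d₁ := by
  obtain ⟨ξ₁, ξ₂, hξ₁, hξ₂, ha', hs₁, hs₂⟩ := hD
  have hd₁ : D.d₁ ≠ 0 := fun h0 => pow_ne_zero 2 hξ₁ (by rw [hs₁, h0, Nat.cast_zero, mul_zero])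
  have hd₂ : D.d₂ ≠ 0 := fun h0 => pow_ne_zero 2 hξ₂ (by rw [hs₂, h0, Nat.cast_zero, mul_zero])
  have e : (ξ₁ - ξ) • D.z₁ + (ξ₂ - ξ) • D.z₂ = 0 := by
    have : ξ₁ • D.z₁ + ξ₂ • D.z₂ = ξ • D.z₁ + ξ • D.z₂ := by
      rw [← ha', ha, ← smul_add, D.z₁_add_z₂]
    rw [sub_smul, sub_smul, sub_add_sub_comm, this, sub_self]
  have hz₁ : D.z₁ * D.z₁ = D.z₁ := by
    have := congrArg (D.z₁ * ·) D.z₁_add_z₂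
    simpa [mul_add, D.z₁_mul_z₂] using this
  have hz₂ : D.z₂ * D.z₂ = D.z₂ := by
    have := congrArg (· * D.z₂) D.z₁_add_z₂
    simpa [add_mul, D.z₁_mul_z₂] using this
  have h₁ : ξ₁ = ξ := by
    have := congrArg (D.z₁ * ·) e
    simpa [mul_add, D.z₁_mul_z₂, hz₁, D.z₁_ne_zero hd₁, sub_eq_zero] using this
  have h₂ : ξ₂ = ξ := by
    have := congrArg (· * D.z₂) e
    simpa [add_mul, D.z₁_mul_z₂, hz₂, D.z₂_ne_zero hd₂, sub_eq_zero] using this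
  subst h₁
  rw [h₂] at hs₂
  refine ⟨hξ₁, ?_, hs₁⟩
  have : (α - β) * ((D.d₁ + D.d₂ : ℕ) : k) = 0 := by
    push_cast
    linear_combination hs₂ - hs₁
  exact (mul_eq_zero.mp this).resolve_left (sub_ne_zero.mpr hne)

end

theorem mainTheorem7 {k : Type u} [Field k] (h t : k)
    (hsep : IsStronglySeparable k (FrobC h t)) (hfield : ¬ IsField (FrobC h t))
    {A : Type v} [Ring A] [Algebra k A] [Coalgebra k A]
    (K : KnowledgeableFrobenius k A (FrobC h t)) (hK : K.IsStateSum) :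
    (∃ α β : k, α + β = h ∧ α * β = -t) ∧
    ∀ α β : k, α + β = h → α * β = -t →
      (∃ D : SkewDecomposition k A, D.HasWindowForm (windowElement k A) α β) ∧
      ∀ D : SkewDecomposition k A, D.HasWindowForm (windowElement k A) α β →
        (K.IsEulerFiltered ↔
          ∃ ξ : k, ξ ≠ 0 ∧ windowElement k A = ξ • (1 : A) ∧
            ringChar k ∣ D.d₁ + D.d₂ ∧ ξ ^ 2 = (α - β) * (D.d₁ : k)) ∧
        (K.IsEulerFiltered →
          ∃ (FA : ℤ → Submodule k A) (FC : ℤ → Submodule k (FrobC h t)),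
            K.IsEulerFiltration FA FC ∧
            HasFiltrationDegree FC 1 2 ∧ HasFiltrationDegree FC (frobX h t) (-2)) := by
  refine ⟨exists_roots_of_not_isField hfield, fun α β h1 h2 => ?_⟩
  have hne := roots_ne_of_isStronglySeparable hsep h1 h2
  refine ⟨hK.exists_skewDecomposition hne h1 h2, fun D hD => ?_⟩
  have hiff : K.IsEulerFiltered ↔ ∃ ξ : k, ξ ≠ 0 ∧ windowElement k A = ξ • (1 : A) ∧
      ringChar k ∣ D.d₁ + D.d₂ ∧ ξ ^ 2 = (α - β) * (D.d₁ : k) := by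
    refine ⟨fun hE => ?_, fun ⟨ξ, hξ, ha, hdvd, _⟩ => ?_⟩
    · obtain ⟨ξ, ha⟩ := hE.exists_window_eq_smul_one hK
      obtain ⟨hξ, hd, hs⟩ := hD.of_eq_smul_one ha hne
      exact ⟨ξ, hξ, ha, (ringChar.spec k _).mp hd, hs⟩
    -- Here `ξ ε_A(1) = d₁ + d₂ = 0` in `k`, and `ξ ≠ 0` leaves `ε_A(1) = 0`.
    · have e := hK.mul_counit_one ha
      rw [D.finrank_eq, (ringChar.spec k _).mpr hdvd] at e
      exact ⟨_, _, hK.isEulerFiltration ha ((mul_eq_zero.mp e).resolve_left hξ)⟩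
  refine ⟨hiff, fun hE => ?_⟩
  obtain ⟨ξ, hξ, ha, hdvd, -⟩ := hiff.mp hE
  have e := hK.mul_counit_one ha
  rw [D.finrank_eq, (ringChar.spec k _).mpr hdvd] at e
  exact ⟨_, _, hK.isEulerFiltration ha ((mul_eq_zero.mp e).resolve_left hξ),
    hasFiltrationDegree_closedFiltration_one h t, hasFiltrationDegree_closedFiltration_x h t⟩
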